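/- Let $X$ and $Y$ be Banach spaces and let $p,q,r\in[1,\infty)$ satisfy $\frac1q=\frac1p+\frac1r$. For a Banach space $E$ and $s\in[1,\infty)$, functions that agree almost everywhere are identified, and for $u\in L^s_{loc}(\mathbb R,E)$ the Bochner transform $u^b:\mathbb R\to L^s(0,1;E)$ is $u^b(t)(\theta)=u(t+\theta)$. Let $BS^s(\mathbb R,E)$ (resp. $S^s_{ap}(\mathbb R,E)$, $S^s_{aa}(\mathbb R,E)$) be the space of all $u\in L^s_{loc}(\mathbb R,E)$ such that $u^b$ is bounded (resp. Bohr almost periodic, almost automorphic), with the norm $\|u\|_{S^s}=\sup_{t\in\mathbb R}\left(\int_0^1\|u(t+\theta)\|^s\,d\theta\right)^{1/s}$. Here a continuous function $U:\mathbb R\to F$ into a Banach space $F$ is Bohr almost periodic if for every $\varepsilon>0$ there is $\ell>0$ such that every interval $[\alpha,\alpha+\ell]$ contains some $\tau$ with $\sup_{t\in\mathbb R}\|U(t+\tau)-U(t)\|\le\varepsilon$, and it is almost automorphic if every real sequence has a subsequence $(t_k)$ for which there is $V:\mathbb R\to F$ with $\lim_k U(t+t_k)=V(t)$ and $\lim_k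 V(t-t_k)=U(t)$ for every $t\in\mathbb R$. Let $f:\mathbb R\times X\to Y$ be a map, and suppose that there is $L\in BS^r(\mathbb R,\mathbb R)$ such that, for almost every $t\in\mathbb R$, $$\|f(t,x_1)-f(t,x_2)\|\le L(t)\,\|x_1-x_2\|\qquad\text{for all }x_1,x_2\in X.$$ Let $\mathcal N_f(u)(t)=f(t,u(t))$. Then the following hold. (i) If $f(\cdot,x)\in S^q_{aa}(\mathbb R,Y)$ for all $x\in X$, then $\mathcal N_f$ maps $S^p_{aa}(\mathbb R,X)$ into $S^q_{aa}(\mathbb R,Y)$ and is continuous for the norms $\|\cdot\|_{S^p}$ and $\|\cdot\|_{S^q}$. (ii) If $f(\cdot,x)\in S^q_{ap}(\mathbb R,Y)$ for all $x\in X$, then $\mathcal N_f$ maps $S^p_{ap}(\mathbb R,X)$ into $S^q_{ap}(\mathbb R,Y)$ and is continuous for the norms $\|\cdot\|_{S^p}$ and $\|\cdot\|_{S^q}$. -/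

import Mathlib

open MeasureTheory Filter Topology
open scoped ENNReal

namespace Stepanov

/-- A subset of the real line is relatively dense if some length `ℓ > 0` is such that every
closed interval of length `ℓ` meets it. -/
def RelativelyDense (D : Set ℝ) : Prop :=
  ∃ ℓ : ℝ, 0 < ℓ ∧ ∀ α : ℝ, (D ∩ Set.Icc α (α + ℓ)).Nonempty

/-- Almost periodic functions in the sense of Bohr, with values in a normed space. -/
def IsAlmostPeriodic {E : Type*} [NormedAddCommGroup E] (U : ℝ → E) : Prop :=
  Continuous U ∧
    ∀ ε : ℝ, 0 < ε → RelativelyDense {τ : ℝ | ∀ t : ℝ, ‖U (t + τ) - U t‖ ≤ ε}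

/-- Almost automorphic functions (in the sense of Bochner), with values in a normed space. -/
def IsAlmostAutomorphic {E : Type*} [NormedAddCommGroup E] (U : ℝ → E) : Prop :=
  Continuous U ∧
    ∀ s : ℕ → ℝ, ∃ φ : ℕ → ℕ, StrictMono φ ∧ ∃ V : ℝ → E, ∀ t : ℝ,
      Tendsto (fun k => U (t + s (φ k))) atTop (𝓝 (V t)) ∧
      Tendsto (fun k => V (t - s (φ k))) atTop (𝓝 (U t))

variable {X : Type*} [NormedAddCommGroup X]

/-- The space `L^p_loc(ℝ, X)`: functions in `L^p(a, b; X)` for every bounded interval. -/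
def MemLpLoc (p : ℝ≥0∞) (u : ℝ → X) : Prop :=
  ∀ a b : ℝ, MemLp u p (volume.restrict (Set.Ioo a b))

theorem MemLpLoc.memLp_translate {p : ℝ≥0∞} {u : ℝ → X} (hu : MemLpLoc p u) (t : ℝ) :
    MemLp (fun θ => u (t + θ)) p (volume.restrict (Set.Ioo (0 : ℝ) 1)) := by
  have h := (measurePreserving_add_left (volume : Measure ℝ) t).restrict_preimage
    (measurableSet_Ioo (a := t) (b := t + 1))
  have hs : (fun x => t + x) ⁻¹' Set.Ioo t (t + 1) = Set.Ioo (0 : ℝ) 1 := by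
    ext x
    simp
  rw [hs] at h
  exact (hu t (t + 1)).comp_measurePreserving h

/-- The space `L^p(0, 1; X)`, as a space of classes of functions. -/
abbrev LpUnit (p : ℝ≥0∞) (X : Type*) [NormedAddCommGroup X] : Type _ :=
  Lp X p (volume.restrict (Set.Ioo (0 : ℝ) 1))

/-- The Bochner transform `u^b : ℝ → L^p(0, 1; X)`, `u^b(t)(θ) = u(t + θ)`. -/
noncomputable def bochnerTransform {p : ℝ≥0∞} {u : ℝ → X} (hu : MemLpLoc p u) (t : ℝ) :
    LpUnit p X :=
  (hu.memLp_translate t).toLp (fun θ => u (t + θ))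

/-- The space `BS^p(ℝ, X)` of bounded functions in the sense of Stepanov. Since `u^b` is
continuous for every `u` in `L^p_loc(ℝ, X)`, boundedness and essential boundedness of `u^b`
agree. -/
def BS (p : ℝ≥0∞) (X : Type*) [NormedAddCommGroup X] [Fact (1 ≤ p)] : Set (ℝ → X) :=
  {u | ∃ hu : MemLpLoc p u, ∃ C : ℝ, ∀ t : ℝ, ‖bochnerTransform hu t‖ ≤ C}

/-- The space `S^p_ap(ℝ, X)` of almost periodic functions in the sense of Stepanov. -/
def Sap (p : ℝ≥0∞) (X : Type*) [NormedAddCommGroup X] [Fact (1 ≤ p)] : Set (ℝ → X) :=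
  {u | ∃ hu : MemLpLoc p u, IsAlmostPeriodic (bochnerTransform hu)}

/-- The space `S^p_aa(ℝ, X)` of almost automorphic functions in the sense of Stepanov. -/
def Saa (p : ℝ≥0∞) (X : Type*) [NormedAddCommGroup X] [Fact (1 ≤ p)] : Set (ℝ → X) :=
  {u | ∃ hu : MemLpLoc p u, IsAlmostAutomorphic (bochnerTransform hu)}

/-- The Stepanov norm `sup_t (∫_0^1 ‖u(t + θ)‖^p dθ)^(1/p)`, with values in `[0, ∞]`. -/
noncomputable def stepanovNorm (p : ℝ≥0∞) (u : ℝ → X) : ℝ≥0∞ :=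
  ⨆ t : ℝ, eLpNorm (fun θ => u (t + θ)) p (volume.restrict (Set.Ioo (0 : ℝ) 1))

/-- Continuity on `S`, for the `S^p` norm on the source and the `S^q` norm on the target. Taken
at two functions that agree almost everywhere, it also says that `N` respects almost everywhere
equality on `S`, so that `N` acts on classes of functions. -/
def StepanovContinuousOn {Y : Type*} [NormedAddCommGroup Y] (p q : ℝ≥0∞)
    (N : (ℝ → X) → (ℝ → Y)) (S : Set (ℝ → X)) : Prop :=
  ∀ u ∈ S, ∀ ε : ℝ, 0 < ε → ∃ δ : ℝ, 0 < δ ∧ ∀ v ∈ S,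
    stepanovNorm p (v - u) < ENNReal.ofReal δ →
      stepanovNorm q (N v - N u) < ENNReal.ofReal ε

/-- The Nemytskii (superposition) operator `𝓝_f(u)(t) = f(t, u(t))`. -/
def nemytskii {X Y : Type*} (f : ℝ → X → Y) (u : ℝ → X) : ℝ → Y :=
  fun t => f t (u t)

end Stepanov

/-! Write `G` for the Bochner transform of `t ↦ f(t, u(t))`. The point is that the oscillation of
`G` is controlled by that of `u^b` and of finitely many `f(·, x)^b`, up to `ε`
(`isControlledBy_nemytskii`). The range of `u^b` is totally bounded in `L^p(0,1;X)`, and since `p <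
∞` simple functions are dense there, so finitely many simple functions `w` approximate every
`u^b(t)`. Replacing `u` by `w` costs little, by the Lipschitz bound and Hölder; at `w`, only its
finitely many values `x` enter.

Such control preserves both properties. For almost automorphy, `ε = 1/(n+1)` involves countably many
`x`, and a diagonal argument yields one subsequence for all of them. Almost periodicity is total
boundedness of the set of translates, which passes through the control. Norm continuity is Hölder
again. -/

namespace Stepanov

/-! ### Common subsequences -/

/-- The function `V` is the limit of the translates of `U` by `s`, and `U` is the limit of the
translates of `V` by `-s`. -/
def TranslatesTo {E : Type*} [NormedAddCommGroup E] (U V : ℝ → E) (s : ℕ → ℝ) : Prop :=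
  ∀ t : ℝ, Tendsto (fun k => U (t + s k)) atTop (𝓝 (V t)) ∧
    Tendsto (fun k => V (t - s k)) atTop (𝓝 (U t))

theorem TranslatesTo.of_eventually_eq {E : Type*} [NormedAddCommGroup E] {U V : ℝ → E}
    {s s' : ℕ → ℝ} (h : TranslatesTo U V s) {m : ℕ → ℕ} (hm : Tendsto m atTop atTop)
    (hs : ∀ᶠ k in atTop, s' k = s (m k)) : TranslatesTo U V s' := fun t =>
  ⟨((h t).1.comp hm).congr' (hs.mono fun k hk => by simp [hk]),
    ((h t).2.comp hm).congr' (hs.mono fun k hk => by simp [hk])⟩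

/-- Diagonal extraction. -/
theorem exists_diagonal_subseq {P : ℕ → (ℕ → ℕ) → Prop}
    (hP : ∀ n φ ψ (m : ℕ → ℕ), P n φ → Tendsto m atTop atTop →
      (∀ᶠ k in atTop, ψ k = φ (m k)) → P n ψ)
    (hex : ∀ n (ψ : ℕ → ℕ), StrictMono ψ → ∃ φ : ℕ → ℕ, StrictMono φ ∧ P n (ψ ∘ φ)) :
    ∃ δ : ℕ → ℕ, StrictMono δ ∧ ∀ n, P n δ := by
  choose! e he heP using hex
  let Ψ : ℕ → ℕ → ℕ := fun n => Nat.rec (e 0 id) (fun n ψ => ψ ∘ e (n + 1) ψ) n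
  have hΨs : ∀ n, Ψ (n + 1) = Ψ n ∘ e (n + 1) (Ψ n) := fun n => rfl
  have hmono : ∀ n, StrictMono (Ψ n) := by
    intro n
    induction n with
    | zero => exact he 0 id strictMono_id
    | succ n ih => rw [hΨs]; exact ih.comp (he _ _ ih)
  have hPΨ : ∀ n, P n (Ψ n) := by
    intro n
    cases n with
    | zero => exact heP 0 id strictMono_id
    | succ n => rw [hΨs]; exact heP _ _ (hmono n)
  have hfac : ∀ n j, ∃ χ : ℕ → ℕ, StrictMono χ ∧ Ψ (n + j) = Ψ n ∘ χ := by
    intro n j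
    induction j with
    | zero => exact ⟨id, strictMono_id, rfl⟩
    | succ j ih =>
      obtain ⟨χ, hχ, h⟩ := ih
      refine ⟨χ ∘ e (n + j + 1) (Ψ (n + j)), hχ.comp (he _ _ (hmono _)), ?_⟩
      rw [← add_assoc, hΨs, ← Function.comp_assoc, ← h]
  choose χ hχ hχΨ using hfac
  refine ⟨fun k => Ψ k k, strictMono_nat_of_lt_succ fun k => ?_, fun n => ?_⟩
  · rw [hΨs]
    exact hmono k ((Nat.lt_succ_self k).trans_le ((he _ _ (hmono k)).le_apply))
  -- For `k ≥ n` the diagonal is `Ψ n` at an index at least `k`; the finitely many `k < n`, where `k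
  -- - n` truncates to `0`, are irrelevant.
  · refine hP n _ _ (fun k => χ n (k - n) k) (hPΨ n)
      (tendsto_atTop_mono (fun k => (hχ n (k - n)).le_apply) tendsto_id) ?_
    filter_upwards [eventually_ge_atTop n] with k hk
    have := hχΨ n (k - n)
    rw [Nat.add_sub_cancel' hk] at this
    rw [this]
    rfl

/-- Countably many almost automorphic functions have a common subsequence. -/
theorem IsAlmostAutomorphic.exists_common_subseq {F : Type*} [NormedAddCommGroup F]
    {U : ℕ → ℝ → F} (hU : ∀ n, IsAlmostAutomorphic (U n)) (s : ℕ → ℝ) :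
    ∃ φ : ℕ → ℕ, StrictMono φ ∧ ∀ n, ∃ V, TranslatesTo (U n) V (s ∘ φ) := by
  refine exists_diagonal_subseq (P := fun n φ => ∃ V, TranslatesTo (U n) V (s ∘ φ)) ?_ ?_
  · rintro n φ ψ m ⟨V, hV⟩ hm h
    exact ⟨V, hV.of_eventually_eq hm (h.mono fun k hk => by simp [hk])⟩
  · intro n ψ _
    obtain ⟨φ, hφ, V, hV⟩ := (hU n).2 (s ∘ ψ)
    exact ⟨φ, hφ, V, hV⟩

/-! ### Control of oscillations and almost automorphy -/

/-- The oscillation of `G` is controlled, up to an arbitrarily small error, by that of `u` and of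
finitely many of the functions `U x`. -/
def IsControlledBy {E F ι : Type*} [NormedAddCommGroup E] [NormedAddCommGroup F]
    (G : ℝ → F) (u : ℝ → E) (U : ι → ℝ → F) : Prop :=
  ∀ ε : ℝ, 0 < ε → ∃ C : ℝ, 0 ≤ C ∧ ∃ T : Finset ι, ∀ t t' : ℝ,
    ‖G t - G t'‖ ≤ ε + C * (‖u t - u t'‖ + ∑ x ∈ T, ‖U x t - U x t'‖)

section Control

variable {E F ι : Type*} [NormedAddCommGroup E] [NormedAddCommGroup F]
  {G : ℝ → F} {u : ℝ → E} {U : ι → ℝ → F}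

theorem IsControlledBy.continuous (h : IsControlledBy G u U) (hu : Continuous u)
    (hU : ∀ x, Continuous (U x)) : Continuous G := by
  rw [continuous_iff_continuousAt]
  intro t
  rw [ContinuousAt, Metric.tendsto_nhds]
  intro ε hε
  obtain ⟨C, _, T, hT⟩ := h (ε / 2) (by positivity)
  have hc : Continuous fun t' => C * (‖u t' - u t‖ + ∑ x ∈ T, ‖U x t' - U x t‖) := by fun_prop
  have h0 := hc.tendsto t
  simp only [sub_self, norm_zero, Finset.sum_const_zero, add_zero, mul_zero] at h0
  filter_upwards [h0.eventually_lt_const (half_pos hε)] with t' ht'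
  rw [dist_eq_norm]
  linarith [hT t' t]

theorem IsControlledBy.isAlmostAutomorphic [CompleteSpace F] [Nonempty ι]
    (h : IsControlledBy G u U) (hu : IsAlmostAutomorphic u)
    (hU : ∀ x, IsAlmostAutomorphic (U x)) : IsAlmostAutomorphic G := by
  refine ⟨h.continuous hu.1 fun x => (hU x).1, fun s => ?_⟩
  choose C hC T hT using fun n : ℕ => h (1 / ((n : ℝ) + 1)) (by positivity)
  obtain ⟨φ₀, hφ₀, v, hv⟩ := hu.2 s
  -- `ι` may be uncountable, but only the countable union of the `T n` matters.
  have hcommon : ∃ φ : ℕ → ℕ, StrictMono φ ∧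
      ∀ n, ∀ x ∈ T n, ∃ W, TranslatesTo (U x) W (s ∘ φ₀ ∘ φ) := by
    obtain ⟨S, hS, hTS⟩ : ∃ S : Set ι, S.Countable ∧ ∀ n, (T n : Set ι) ⊆ S :=
      ⟨⋃ n, (T n : Set ι), Set.countable_iUnion fun n => (T n).countable_toSet,
        fun n => Set.subset_iUnion (fun n => (T n : Set ι)) n⟩
    obtain ⟨e, he⟩ := Set.countable_iff_exists_subset_range.1 hS
    obtain ⟨φ, hφ, hV⟩ :=
      IsAlmostAutomorphic.exists_common_subseq (fun n => hU (e n)) (s ∘ φ₀)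
    refine ⟨φ, hφ, fun n x hx => ?_⟩
    obtain ⟨k, rfl⟩ := he (hTS n hx)
    exact hV k
  obtain ⟨φ₁, hφ₁, hW⟩ := hcommon
  replace hv : TranslatesTo u v (s ∘ φ₀ ∘ φ₁) :=
    TranslatesTo.of_eventually_eq hv hφ₁.tendsto_atTop (Eventually.of_forall fun k => rfl)
  refine ⟨φ₀ ∘ φ₁, hφ₀.comp hφ₁, ?_⟩
  set s' := s ∘ φ₀ ∘ φ₁
  have hs'' : ∀ k, s ((φ₀ ∘ φ₁) k) = s' k := fun k => rfl
  simp only [hs'']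
  clear_value s'
  choose! W hW using fun x (hx : ∃ n, x ∈ T n) => hW _ x hx.choose_spec
  replace hW : ∀ n, ∀ x ∈ T n, TranslatesTo (U x) (W x) s' := fun n x hx => hW x ⟨n, hx⟩
  have hsmall : ∀ ε : ℝ, 0 < ε → ∃ n : ℕ, 1 / ((n : ℝ) + 1) < ε :=
    fun ε hε => exists_nat_one_div_lt hε
  have hcauchy : ∀ t, CauchySeq fun k => G (t + s' k) := by
    intro t
    rw [Metric.cauchySeq_iff']
    intro ε hε
    obtain ⟨n, hn⟩ := hsmall (ε / 2) (by positivity)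
    have hlim : Tendsto (fun kj : ℕ × ℕ => C n * (‖u (t + s' kj.1) - u (t + s' kj.2)‖ +
        ∑ x ∈ T n, ‖U x (t + s' kj.1) - U x (t + s' kj.2)‖)) atTop
        (𝓝 (C n * (‖v t - v t‖ + ∑ x ∈ T n, ‖W x t - W x t‖))) := by
      rw [← prod_atTop_atTop_eq]
      refine Tendsto.const_mul _ (Tendsto.add ?_ (tendsto_finsetSum _ fun x hx => ?_))
      · exact (((hv t).1.comp tendsto_fst).sub ((hv t).1.comp tendsto_snd)).norm
      · exact (((hW n x hx t).1.comp tendsto_fst).sub ((hW n x hx t).1.comp tendsto_snd)).norm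
    simp only [sub_self, norm_zero, Finset.sum_const_zero, add_zero, mul_zero] at hlim
    obtain ⟨⟨N₁, N₂⟩, hN⟩ := eventually_atTop.1 (hlim.eventually_lt_const (half_pos hε))
    refine ⟨max N₁ N₂, fun k hk => ?_⟩
    have h1 := hN (k, max N₁ N₂) ⟨(le_max_left _ _).trans hk, le_max_right _ _⟩
    have h2 := hT n (t + s' k) (t + s' (max N₁ N₂))
    rw [dist_eq_norm]
    simp only at h1
    linarith
  choose H hH using fun t => cauchySeq_tendsto_of_complete (hcauchy t)
  -- The control inequality survives the limit in its first point; taking that point to be `t - s'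
  -- k` will give the return convergence.
  have hbound : ∀ (n : ℕ) (t t' : ℝ), ‖H t - G t'‖ ≤
      1 / ((n : ℝ) + 1) + C n * (‖v t - u t'‖ + ∑ x ∈ T n, ‖W x t - U x t'‖) := by
    intro n t t'
    refine le_of_tendsto_of_tendsto' ((hH t).sub_const (G t')).norm
      (Tendsto.const_add _ (Tendsto.const_mul _ (Tendsto.add ?_
        (tendsto_finsetSum _ fun x hx => ?_)))) fun k => hT n (t + s' k) t'
    · exact ((hv t).1.sub_const _).norm
    · exact ((hW n x hx t).1.sub_const _).norm
  refine ⟨H, fun t => ⟨hH t, ?_⟩⟩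
  rw [Metric.tendsto_nhds]
  intro ε hε
  obtain ⟨n, hn⟩ := hsmall (ε / 2) (by positivity)
  have hlim : Tendsto (fun k => C n * (‖v (t - s' k) - u t‖ +
      ∑ x ∈ T n, ‖W x (t - s' k) - U x t‖)) atTop
      (𝓝 (C n * (‖u t - u t‖ + ∑ x ∈ T n, ‖U x t - U x t‖))) :=
    Tendsto.const_mul _ (Tendsto.add ((hv t).2.sub_const _).norm
      (tendsto_finsetSum _ fun x hx => ((hW n x hx t).2.sub_const _).norm))
  simp only [sub_self, norm_zero, Finset.sum_const_zero, add_zero, mul_zero] at hlim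
  filter_upwards [hlim.eventually_lt_const (half_pos hε)] with k hk
  rw [dist_eq_norm]
  linarith [hbound n (t - s' k) t]

end Control

/-- Otherwise some sequence has `ε`-separated values, yet a subsequence of these converges (take `t
= 0` in the definition). -/
theorem IsAlmostAutomorphic.exists_finset_net {E : Type*} [NormedAddCommGroup E] {u : ℝ → E}
    (hu : IsAlmostAutomorphic u) {ε : ℝ} (hε : 0 < ε) :
    ∃ S : Finset ℝ, ∀ t, ∃ t₀ ∈ S, ‖u t - u t₀‖ ≤ ε := by
  by_contra! hcon
  obtain ⟨s, -, hs⟩ := exists_seq_of_forall_finset_exists (fun _ : ℝ => True)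
    (fun t₀ t => ε < ‖u t - u t₀‖) fun S _ => by
      obtain ⟨t, ht⟩ := hcon S
      exact ⟨t, trivial, ht⟩
  obtain ⟨φ, hφ, v, hv⟩ := hu.2 s
  obtain ⟨N, hN⟩ := Metric.cauchySeq_iff'.1 (hv 0).1.cauchySeq ε hε
  have h1 := hN (N + 1) (Nat.le_succ N)
  have h2 := hs _ _ (hφ (Nat.lt_succ_self N))
  rw [dist_eq_norm] at h1
  simp only [zero_add] at h1
  exact lt_asymm h1 h2

/-! ### Almost periodicity as precompactness of translates -/

/-- The translates of `U` are totally bounded for the uniform distance: up to `ε` there are only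
finitely many of them. -/
def HasPrecompactTranslates {E : Type*} [NormedAddCommGroup E] (U : ℝ → E) : Prop :=
  ∀ ε : ℝ, 0 < ε → ∃ (κ : Type) (_ : Finite κ) (c : ℝ → κ), ∀ s s', c s = c s' →
    ∀ t, ‖U (t + s) - U (t + s')‖ ≤ ε

section AlmostPeriodic

variable {E : Type*} [NormedAddCommGroup E] {U : ℝ → E}

theorem IsAlmostPeriodic.uniformContinuous (hU : IsAlmostPeriodic U) : UniformContinuous U := by
  rw [Metric.uniformContinuous_iff]
  intro ε hε
  obtain ⟨ℓ, hℓ, hper⟩ := hU.2 (ε / 4) (by positivity)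
  obtain ⟨δ, hδ, hUC⟩ := Metric.uniformContinuousOn_iff.1
    ((isCompact_Icc (a := -1) (b := ℓ + 1)).uniformContinuousOn_of_continuous
      hU.1.continuousOn) (ε / 4) (by positivity)
  -- An almost period moves `a` into `[0, ℓ]`, hence `b` into `[-1, ℓ + 1]`.
  refine ⟨min δ 1, by positivity, fun {a b} hab => ?_⟩
  obtain ⟨τ, hτ, hτ1, hτ2⟩ := hper (-a)
  rw [lt_min_iff, Real.dist_eq] at hab
  have hab' := abs_lt.1 hab.2
  have h := hUC (a + τ) ⟨by linarith, by linarith⟩ (b + τ) ⟨by linarith, by linarith⟩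
    (by rw [Real.dist_eq]; simpa using hab.1)
  have ha := hτ a
  have hb := hτ b
  rw [← dist_eq_norm] at ha hb
  have := dist_triangle4 (U a) (U (a + τ)) (U (b + τ)) (U b)
  rw [dist_comm (U a) (U (a + τ))] at this
  linarith

/-- Modulo an almost period every shift lies in `[0, ℓ]`, which is cut into cells of length `δ`
given by uniform continuity. -/
theorem IsAlmostPeriodic.hasPrecompactTranslates (hU : IsAlmostPeriodic U) :
    HasPrecompactTranslates U := by
  intro ε hε
  obtain ⟨ℓ, hℓ, hper⟩ := hU.2 (ε / 4) (by positivity)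
  obtain ⟨δ, hδ, hUC⟩ := Metric.uniformContinuous_iff.1 hU.uniformContinuous (ε / 4)
    (by positivity)
  have hdec : ∀ s, ∃ σ ∈ Set.Icc 0 ℓ, ∀ t, ‖U (t + s) - U (t + σ)‖ ≤ ε / 4 := by
    intro s
    obtain ⟨τ, hτ, hτ1, hτ2⟩ := hper (s - ℓ)
    refine ⟨s - τ, ⟨by linarith, by linarith⟩, fun t => ?_⟩
    have := hτ (t + (s - τ))
    rwa [show t + (s - τ) + τ = t + s by ring] at this
  choose σ hσ hUσ using hdec
  refine ⟨Fin (⌊ℓ / δ⌋₊ + 1), inferInstance, fun s => ⟨⌊σ s / δ⌋₊, Nat.lt_succ_of_le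
    (Nat.floor_le_floor (by gcongr; exact (hσ s).2))⟩, fun s s' hc t => ?_⟩
  have hc' : ⌊σ s / δ⌋₊ = ⌊σ s' / δ⌋₊ := congrArg Fin.val hc
  have hclose : dist (t + σ s) (t + σ s') < δ := by
    have h1 := Nat.floor_le (div_nonneg (hσ s).1 hδ.le)
    have h2 := Nat.lt_floor_add_one (σ s / δ)
    have h3 := Nat.floor_le (div_nonneg (hσ s').1 hδ.le)
    have h4 := Nat.lt_floor_add_one (σ s' / δ)
    rw [hc'] at h1 h2
    have h5 : |σ s / δ - σ s' / δ| < 1 := abs_lt.2 ⟨by linarith, by linarith⟩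
    rw [← sub_div, abs_div, abs_of_pos hδ, div_lt_one hδ] at h5
    rwa [Real.dist_eq, add_sub_add_left_eq_sub]
  have h := hUC hclose
  have h1 := hUσ s t
  have h2 := hUσ s' t
  rw [← dist_eq_norm] at h1 h2 ⊢
  have := dist_triangle4 (U (t + s)) (U (t + σ s)) (U (t + σ s')) (U (t + s'))
  rw [dist_comm (U (t + σ s')) (U (t + s'))] at this
  linarith

theorem exists_finset_forall_eq {κ : Type} [Finite κ] (c : ℝ → κ) :
    ∃ S : Finset ℝ, ∀ s, ∃ s₀ ∈ S, c s = c s₀ := by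
  refine ⟨(Set.finite_range (Set.rangeSplitting c)).toFinset, fun s =>
    ⟨Set.rangeSplitting c ⟨c s, s, rfl⟩, by simp, (Set.apply_rangeSplitting c ⟨c s, s, rfl⟩).symm⟩⟩

/-- The difference between a shift and the representative of its class is an almost period;
representatives are bounded by `R`, so starting from `α + R` lands in `[α, α + 2R]`. -/
theorem HasPrecompactTranslates.isAlmostPeriodic (hU : HasPrecompactTranslates U)
    (hc : Continuous U) : IsAlmostPeriodic U := by
  refine ⟨hc, fun ε hε => ?_⟩
  obtain ⟨κ, _, c, hκ⟩ := hU ε hε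
  obtain ⟨S, hS⟩ := exists_finset_forall_eq c
  obtain ⟨R, hR⟩ := S.finite_toSet.isBounded.exists_pos_norm_le
  refine ⟨2 * R, by linarith, fun α => ?_⟩
  obtain ⟨s₀, hs₀, h⟩ := hS (α + R)
  have hb := abs_le.1 (hR.2 s₀ hs₀)
  refine ⟨α + R - s₀, fun t => ?_, by linarith, by linarith⟩
  have := hκ _ _ h (t - s₀)
  rwa [sub_add_cancel, show t - s₀ + (α + R) = t + (α + R - s₀) by ring] at this

theorem IsAlmostPeriodic.exists_finset_net (hU : IsAlmostPeriodic U) {ε : ℝ} (hε : 0 < ε) :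
    ∃ S : Finset ℝ, ∀ t, ∃ t₀ ∈ S, ‖U t - U t₀‖ ≤ ε := by
  obtain ⟨κ, _, c, hκ⟩ := hU.hasPrecompactTranslates ε hε
  obtain ⟨S, hS⟩ := exists_finset_forall_eq c
  refine ⟨S, fun t => ?_⟩
  obtain ⟨s₀, hs₀, h⟩ := hS t
  exact ⟨s₀, hs₀, by simpa using hκ _ _ h 0⟩

theorem HasPrecompactTranslates.finset {ι : Type*} {U : ι → ℝ → E}
    (hU : ∀ x, HasPrecompactTranslates (U x)) (T : Finset ι) {ε : ℝ} (hε : 0 < ε) :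
    ∃ (κ : Type) (_ : Finite κ) (c : ℝ → κ), ∀ s s', c s = c s' →
      ∀ t, ∀ x ∈ T, ‖U x (t + s) - U x (t + s')‖ ≤ ε := by
  classical
  induction T using Finset.induction_on with
  | empty => exact ⟨Unit, inferInstance, fun _ => (), by simp⟩
  | insert x T _ ih =>
    obtain ⟨κ, _, c, hc⟩ := ih
    obtain ⟨κ', _, c', hc'⟩ := hU x ε hε
    refine ⟨κ × κ', inferInstance, fun s => (c s, c' s), fun s s' h t y hy => ?_⟩
    rw [Prod.mk.injEq] at h
    rcases Finset.mem_insert.1 hy with rfl | hy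
    · exact hc' _ _ h.2 t
    · exact hc _ _ h.1 t y hy

end AlmostPeriodic

theorem IsControlledBy.isAlmostPeriodic {E F ι : Type*} [NormedAddCommGroup E]
    [NormedAddCommGroup F] {G : ℝ → F} {u : ℝ → E} {U : ι → ℝ → F}
    (h : IsControlledBy G u U) (hu : IsAlmostPeriodic u)
    (hU : ∀ x, IsAlmostPeriodic (U x)) : IsAlmostPeriodic G := by
  refine HasPrecompactTranslates.isAlmostPeriodic (fun ε hε => ?_)
    (h.continuous hu.1 fun x => (hU x).1)
  obtain ⟨C, hC, T, hT⟩ := h (ε / 2) (by positivity)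
  set η : ℝ := ε / 2 / ((C + 1) * (1 + T.card)) with hη
  have hη0 : 0 < η := by positivity
  obtain ⟨κ, _, c, hc⟩ := hu.hasPrecompactTranslates η hη0
  obtain ⟨κ', _, c', hc'⟩ :=
    HasPrecompactTranslates.finset (fun x => (hU x).hasPrecompactTranslates) T hη0
  refine ⟨κ × κ', inferInstance, fun s => (c s, c' s), fun s s' hs t => ?_⟩
  rw [Prod.mk.injEq] at hs
  have h1 := hc _ _ hs.1 t
  have h2 := Finset.sum_le_card_nsmul T _ η (hc' _ _ hs.2 t)
  rw [nsmul_eq_mul] at h2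
  have h3 : (C + 1) * ((1 + T.card) * η) = ε / 2 := by rw [hη]; field_simp
  have h4 : 0 ≤ (1 + (T.card : ℝ)) * η := by positivity
  calc ‖G (t + s) - G (t + s')‖ ≤ _ := hT _ _
    _ ≤ ε / 2 + C * ((1 + T.card) * η) := by gcongr; linarith
    _ ≤ ε := by linarith

/-! ### Superposition estimates on a measure space -/

section SimpleFunc

variable {α X Y : Type*} [MeasurableSpace α] {μ : Measure α} [NormedAddCommGroup Y]
  {f g : α → X → Y}

theorem aestronglyMeasurable_comp_simpleFunc (hf : ∀ x, AEStronglyMeasurable (fun a => f a x) μ)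
    (w : SimpleFunc α X) : AEStronglyMeasurable (fun a => f a (w a)) μ := by
  classical
  have h : (fun a => f a (w a)) =
      fun a => ∑ x ∈ w.range, (w ⁻¹' {x}).indicator (fun a => f a x) a := by
    funext a
    rw [Finset.sum_eq_single (w a)]
    · simp
    · intro x _ hx
      exact Set.indicator_of_notMem (fun h => hx (Eq.symm h)) _
    · intro h
      exact absurd (w.mem_range_self a) h
  rw [h]
  exact Finset.aestronglyMeasurable_fun_sum _ fun x _ => (hf x).indicator (w.measurableSet_fiber x)

theorem eLpNorm_comp_simpleFunc_sub_le {q : ℝ≥0∞} (hq : 1 ≤ q)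
    (hf : ∀ x, AEStronglyMeasurable (fun a => f a x) μ)
    (hg : ∀ x, AEStronglyMeasurable (fun a => g a x) μ) (w : SimpleFunc α X) :
    eLpNorm (fun a => f a (w a) - g a (w a)) q μ ≤
      ∑ x ∈ w.range, eLpNorm (fun a => f a x - g a x) q μ := by
  calc eLpNorm (fun a => f a (w a) - g a (w a)) q μ
      ≤ eLpNorm (∑ x ∈ w.range, fun a => ‖f a x - g a x‖) q μ :=
        eLpNorm_mono_real fun a => by
          rw [Finset.sum_apply]
          exact Finset.single_le_sum (f := fun x => ‖f a x - g a x‖)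
            (fun _ _ => norm_nonneg _) (w.mem_range_self a)
    _ ≤ ∑ x ∈ w.range, eLpNorm (fun a => ‖f a x - g a x‖) q μ :=
        eLpNorm_sum_le (fun x _ => ((hf x).sub (hg x)).norm) hq
    _ = _ := by simp only [eLpNorm_norm]

end SimpleFunc

section Superposition

variable {α X Y : Type*} [MeasurableSpace α] {μ : Measure α} [NormedAddCommGroup X]
  [NormedAddCommGroup Y] {f g : α → X → Y} {L M : α → ℝ}

/-- For almost every `a` the map `f a` is continuous, so simple approximations of `u` pass to the
limit. -/
theorem aestronglyMeasurable_superposition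
    (hL : ∀ᵐ a ∂μ, ∀ x₁ x₂ : X, ‖f a x₁ - f a x₂‖ ≤ L a * ‖x₁ - x₂‖)
    (hf : ∀ x, AEStronglyMeasurable (fun a => f a x) μ) {u : α → X}
    (hu : AEStronglyMeasurable u μ) : AEStronglyMeasurable (fun a => f a (u a)) μ := by
  refine aestronglyMeasurable_of_tendsto_ae atTop
    (fun n => aestronglyMeasurable_comp_simpleFunc hf (hu.stronglyMeasurable_mk.approx n)) ?_
  filter_upwards [hL, hu.ae_eq_mk] with a ha hua
  rw [hua, tendsto_iff_norm_sub_tendsto_zero]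
  have h := tendsto_iff_norm_sub_tendsto_zero.1 (hu.stronglyMeasurable_mk.tendsto_approx a)
  exact squeeze_zero (fun _ => norm_nonneg _) (fun n => ha _ _) (by simpa using h.const_mul (L a))

theorem eLpNorm_superposition_sub_le {p q r : ℝ≥0∞} [ENNReal.HolderTriple r p q]
    (hL : ∀ᵐ a ∂μ, ∀ x₁ x₂ : X, ‖f a x₁ - f a x₂‖ ≤ L a * ‖x₁ - x₂‖)
    (hLm : AEStronglyMeasurable L μ) {u v : α → X} (hu : AEStronglyMeasurable u μ)
    (hv : AEStronglyMeasurable v μ) :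
    eLpNorm (fun a => f a (u a) - f a (v a)) q μ ≤
      eLpNorm L r μ * eLpNorm (fun a => u a - v a) p μ := by
  calc eLpNorm (fun a => f a (u a) - f a (v a)) q μ
      ≤ eLpNorm (L • fun a => ‖u a - v a‖) q μ :=
        eLpNorm_mono_ae_real (hL.mono fun a ha => ha _ _)
    _ ≤ eLpNorm L r μ * eLpNorm (fun a => ‖u a - v a‖) p μ :=
        eLpNorm_smul_le_mul_eLpNorm (hu.sub hv).norm hLm
    _ = _ := by rw [eLpNorm_norm]

/-- Passing through `w` separates the change of argument (Hölder) from the change of map, which is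
then only seen at the values of `w`. -/
theorem eLpNorm_superposition_sub_superposition_le {p q r : ℝ≥0∞} [ENNReal.HolderTriple r p q]
    (hq : 1 ≤ q)
    (hL : ∀ᵐ a ∂μ, ∀ x₁ x₂ : X, ‖f a x₁ - f a x₂‖ ≤ L a * ‖x₁ - x₂‖)
    (hM : ∀ᵐ a ∂μ, ∀ x₁ x₂ : X, ‖g a x₁ - g a x₂‖ ≤ M a * ‖x₁ - x₂‖)
    (hLm : AEStronglyMeasurable L μ) (hMm : AEStronglyMeasurable M μ)
    (hf : ∀ x, AEStronglyMeasurable (fun a => f a x) μ)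
    (hg : ∀ x, AEStronglyMeasurable (fun a => g a x) μ) {u v : α → X}
    (hu : AEStronglyMeasurable u μ) (hv : AEStronglyMeasurable v μ) (w : SimpleFunc α X) :
    eLpNorm (fun a => f a (u a) - g a (v a)) q μ ≤
      eLpNorm L r μ * eLpNorm (fun a => u a - w a) p μ +
        eLpNorm M r μ * eLpNorm (fun a => v a - w a) p μ +
        ∑ x ∈ w.range, eLpNorm (fun a => f a x - g a x) q μ := by
  have hw : AEStronglyMeasurable w μ := w.aestronglyMeasurable
  have hfu := aestronglyMeasurable_superposition hL hf hu
  have hfw := aestronglyMeasurable_superposition hL hf hw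
  have hgv := aestronglyMeasurable_superposition hM hg hv
  have hgw := aestronglyMeasurable_superposition hM hg hw
  have hsplit : (fun a => f a (u a) - g a (v a)) = ((fun a => f a (u a) - f a (w a)) -
      fun a => g a (v a) - g a (w a)) + fun a => f a (w a) - g a (w a) := by
    funext a
    simp only [Pi.add_apply, Pi.sub_apply]
    abel
  rw [hsplit]
  refine (eLpNorm_add_le ((hfu.sub hfw).sub (hgv.sub hgw)) (hfw.sub hgw) hq).trans ?_
  refine add_le_add ((eLpNorm_sub_le (hfu.sub hfw) (hgv.sub hgw) hq).trans ?_)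
    (eLpNorm_comp_simpleFunc_sub_le hq hf hg w)
  exact add_le_add (eLpNorm_superposition_sub_le hL hLm hu hw)
    (eLpNorm_superposition_sub_le hM hMm hv hw)

end Superposition

/-! ### Transfer to Bochner transforms -/

section Bochner

variable {X Y : Type*} [NormedAddCommGroup X] [NormedAddCommGroup Y] {p q r : ℝ≥0∞}

theorem enorm_bochnerTransform_sub [Fact (1 ≤ p)] {u : ℝ → X} (hu : MemLpLoc p u) (t t' : ℝ) :
    ‖bochnerTransform hu t - bochnerTransform hu t'‖ₑ =
      eLpNorm (fun θ => u (t + θ) - u (t' + θ)) p (volume.restrict (Set.Ioo (0 : ℝ) 1)) := by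
  rw [bochnerTransform, bochnerTransform, ← MemLp.toLp_sub, Lp.enorm_toLp]
  rfl

theorem enorm_bochnerTransform_sub_toLp [Fact (1 ≤ p)] {u : ℝ → X} (hu : MemLpLoc p u)
    {w : ℝ → X} (hw : MemLp w p (volume.restrict (Set.Ioo (0 : ℝ) 1))) (t : ℝ) :
    ‖bochnerTransform hu t - hw.toLp w‖ₑ =
      eLpNorm (fun θ => u (t + θ) - w θ) p (volume.restrict (Set.Ioo (0 : ℝ) 1)) := by
  rw [bochnerTransform, ← MemLp.toLp_sub, Lp.enorm_toLp]
  rfl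

theorem BS.exists_bound [Fact (1 ≤ p)] {u : ℝ → X} (hu : u ∈ BS p X) :
    ∃ K : ℝ, 0 ≤ K ∧ ∀ t : ℝ, eLpNorm (fun θ => u (t + θ)) p
      (volume.restrict (Set.Ioo (0 : ℝ) 1)) ≤ ENNReal.ofReal K := by
  obtain ⟨h, C, hC⟩ := hu
  refine ⟨C, (norm_nonneg _).trans (hC 0), fun t => ?_⟩
  rw [← Lp.enorm_toLp (hf := h.memLp_translate t), ← ofReal_norm]
  exact ENNReal.ofReal_le_ofReal (hC t)

theorem ae_translate {P : ℝ → Prop} (h : ∀ᵐ t : ℝ, P t) (t : ℝ) :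
    ∀ᵐ θ ∂volume.restrict (Set.Ioo (0 : ℝ) 1), P (t + θ) :=
  ae_restrict_of_ae
    ((measurePreserving_add_left (volume : Measure ℝ) t).quasiMeasurePreserving.ae h)

variable {f : ℝ → X → Y} {L : ℝ → ℝ}

/-- Hölder bounds the difference with `f(·, 0)`, itself locally in `L^q`. -/
theorem MemLpLoc.nemytskii [ENNReal.HolderTriple r p q] [Fact (1 ≤ q)] (hL : MemLpLoc r L)
    (hfL : ∀ᵐ t : ℝ, ∀ x₁ x₂ : X, ‖f t x₁ - f t x₂‖ ≤ L t * ‖x₁ - x₂‖)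
    (hf : ∀ x, MemLpLoc q fun t => f t x) {u : ℝ → X} (hu : MemLpLoc p u) :
    MemLpLoc q (Stepanov.nemytskii f u) := by
  intro a b
  have hfL' := ae_restrict_of_ae (s := Set.Ioo a b) hfL
  have hm := aestronglyMeasurable_superposition hfL' (fun x => (hf x a b).1) (hu a b).1
  have hbound := eLpNorm_superposition_sub_le (p := p) (q := q) (r := r) hfL' (hL a b).1
    (hu a b).1 (aestronglyMeasurable_const (b := (0 : X)))
  simp only [sub_zero] at hbound
  have hdiff : MemLp (fun t => f t (u t) - f t 0) q (volume.restrict (Set.Ioo a b)) :=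
    ⟨hm.sub (hf 0 a b).1, hbound.trans_lt (ENNReal.mul_lt_top (hL a b).2 (hu a b).2)⟩
  convert hdiff.add (hf 0 a b) using 1
  funext t
  simp [Stepanov.nemytskii]

theorem isControlledBy_nemytskii [ENNReal.HolderTriple r p q] [Fact (1 ≤ p)] [Fact (1 ≤ q)]
    [Fact (1 ≤ r)] (hp : p ≠ ∞) (hL : L ∈ BS r ℝ)
    (hfL : ∀ᵐ t : ℝ, ∀ x₁ x₂ : X, ‖f t x₁ - f t x₂‖ ≤ L t * ‖x₁ - x₂‖)
    (hf : ∀ x, MemLpLoc q fun t => f t x) {u : ℝ → X} (hu : MemLpLoc p u)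
    (hnet : ∀ ε : ℝ, 0 < ε → ∃ S : Finset ℝ, ∀ t, ∃ t₀ ∈ S,
      ‖bochnerTransform hu t - bochnerTransform hu t₀‖ ≤ ε)
    (hN : MemLpLoc q (nemytskii f u)) :
    IsControlledBy (bochnerTransform hN) (bochnerTransform hu)
      (fun x => bochnerTransform (hf x)) := by
  classical
  obtain ⟨K, hK, hLK⟩ := BS.exists_bound hL
  obtain ⟨hLloc, -⟩ := hL
  intro ε hε
  -- With `η` this number, `u^b(t)` is `2η`-close to `w t₀` and `u^b(t')` is so up to `D`: four
  -- errors `η`, each weighted by at most `K + 1`.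
  have hη : 0 < ε / (4 * (K + 1)) := by positivity
  obtain ⟨S, hS⟩ := hnet _ hη
  choose w hw hwmem using fun t : ℝ => (hu.memLp_translate t).exists_simpleFunc_eLpNorm_sub_lt hp
    (ENNReal.ofReal_pos.2 hη).ne'
  -- All values over the whole net are collected, so that the finite set does not depend on `t`.
  refine ⟨K + 1, by positivity, S.biUnion fun t => (w t).range, fun t t' => ?_⟩
  obtain ⟨t₀, ht₀, hclose⟩ := hS t
  have hw₀ : ‖bochnerTransform hu t₀ - (hwmem t₀).toLp (w t₀)‖ ≤ ε / (4 * (K + 1)) := by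
    rw [← ENNReal.ofReal_le_ofReal_iff hη.le, ofReal_norm, enorm_bochnerTransform_sub_toLp]
    exact (hw t₀).le
  have key : ‖bochnerTransform hN t - bochnerTransform hN t'‖ ≤
      K * ‖bochnerTransform hu t - (hwmem t₀).toLp (w t₀)‖ +
        K * ‖bochnerTransform hu t' - (hwmem t₀).toLp (w t₀)‖ +
        ∑ x ∈ (w t₀).range, ‖bochnerTransform (hf x) t - bochnerTransform (hf x) t'‖ := by
    rw [← ENNReal.ofReal_le_ofReal_iff (by positivity), ENNReal.ofReal_add (by positivity)
      (by positivity), ENNReal.ofReal_add (by positivity) (by positivity),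
      ENNReal.ofReal_mul hK, ENNReal.ofReal_mul hK,
      ENNReal.ofReal_sum_of_nonneg fun _ _ => norm_nonneg _]
    simp only [ofReal_norm, enorm_bochnerTransform_sub, enorm_bochnerTransform_sub_toLp]
    refine (eLpNorm_superposition_sub_superposition_le (p := p) (q := q) (r := r) Fact.out
      (ae_translate hfL t) (ae_translate hfL t') (hLloc.memLp_translate t).1
      (hLloc.memLp_translate t').1 (fun x => ((hf x).memLp_translate t).1)
      (fun x => ((hf x).memLp_translate t').1) (hu.memLp_translate t).1
      (hu.memLp_translate t').1 (w t₀)).trans ?_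
    gcongr
    · exact hLK t
    · exact hLK t'
  have hsum : ∑ x ∈ (w t₀).range, ‖bochnerTransform (hf x) t - bochnerTransform (hf x) t'‖ ≤
      ∑ x ∈ S.biUnion fun t => (w t).range,
        ‖bochnerTransform (hf x) t - bochnerTransform (hf x) t'‖ :=
    Finset.sum_le_sum_of_subset_of_nonneg
      (Finset.subset_biUnion_of_mem (fun t => (w t).range) ht₀) fun _ _ _ => norm_nonneg _
  have h1 := norm_sub_le_norm_sub_add_norm_sub (bochnerTransform hu t) (bochnerTransform hu t₀)
    ((hwmem t₀).toLp (w t₀))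
  have h2 := norm_sub_le_norm_sub_add_norm_sub (bochnerTransform hu t') (bochnerTransform hu t)
    ((hwmem t₀).toLp (w t₀))
  rw [norm_sub_rev _ (bochnerTransform hu t)] at h2
  have h3 : (K + 1) * (4 * (ε / (4 * (K + 1)))) = ε := by field_simp
  set A := ‖bochnerTransform hu t - (hwmem t₀).toLp (w t₀)‖
  set B := ‖bochnerTransform hu t' - (hwmem t₀).toLp (w t₀)‖
  set D := ‖bochnerTransform hu t - bochnerTransform hu t'‖
  set s₀ := ∑ x ∈ (w t₀).range, ‖bochnerTransform (hf x) t - bochnerTransform (hf x) t'‖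
  set s₁ := ∑ x ∈ S.biUnion fun t => (w t).range,
        ‖bochnerTransform (hf x) t - bochnerTransform (hf x) t'‖
  have hs₁ : 0 ≤ s₁ := Finset.sum_nonneg fun _ _ => norm_nonneg _
  have h4 : (K + 1) * (A + B) ≤ (K + 1) * (4 * (ε / (4 * (K + 1))) + D) :=
    mul_le_mul_of_nonneg_left (by linarith) (by positivity)
  have hA : 0 ≤ A := norm_nonneg _
  have hB : 0 ≤ B := norm_nonneg _
  nlinarith [mul_nonneg hK hs₁]

theorem stepanovContinuousOn_nemytskii [ENNReal.HolderTriple r p q] [Fact (1 ≤ r)]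
    (hL : L ∈ BS r ℝ)
    (hfL : ∀ᵐ t : ℝ, ∀ x₁ x₂ : X, ‖f t x₁ - f t x₂‖ ≤ L t * ‖x₁ - x₂‖)
    {S : Set (ℝ → X)} (hS : ∀ u ∈ S, MemLpLoc p u) :
    StepanovContinuousOn p q (nemytskii f) S := by
  obtain ⟨K, hK, hLK⟩ := BS.exists_bound hL
  obtain ⟨hLloc, -⟩ := hL
  intro u hu ε hε
  refine ⟨ε / (K + 1), by positivity, fun v hv hvu => ?_⟩
  have hle : stepanovNorm q (nemytskii f v - nemytskii f u) ≤
      ENNReal.ofReal K * stepanovNorm p (v - u) := by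
    refine iSup_le fun t => ?_
    refine (eLpNorm_superposition_sub_le (p := p) (q := q) (r := r) (ae_translate hfL t)
      (hLloc.memLp_translate t).1 ((hS v hv).memLp_translate t).1
      ((hS u hu).memLp_translate t).1).trans ?_
    exact mul_le_mul' (hLK t) (le_iSup (fun t => eLpNorm (fun θ => (v - u) (t + θ)) p
      (volume.restrict (Set.Ioo (0 : ℝ) 1))) t)
  calc stepanovNorm q (nemytskii f v - nemytskii f u)
      ≤ ENNReal.ofReal K * ENNReal.ofReal (ε / (K + 1)) := hle.trans (by gcongr)
    _ = ENNReal.ofReal (K * (ε / (K + 1))) := (ENNReal.ofReal_mul hK).symm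
    _ < ENNReal.ofReal ε := by
        rw [ENNReal.ofReal_lt_ofReal_iff hε, mul_div_assoc', div_lt_iff₀ (by positivity)]
        linarith

end Bochner

end Stepanov

theorem mainTheorem10
    {X Y : Type*} [NormedAddCommGroup X] [NormedSpace ℝ X] [CompleteSpace X]
    [NormedAddCommGroup Y] [NormedSpace ℝ Y] [CompleteSpace Y]
    (p q r : ℝ≥0∞) [Fact (1 ≤ p)] [Fact (1 ≤ q)] [Fact (1 ≤ r)]
    (hp : p ≠ ∞) (hq : q ≠ ∞) (hr : r ≠ ∞)
    (hpqr : 1 / q = 1 / p + 1 / r)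
    (f : ℝ → X → Y)
    (hf : ∃ L ∈ Stepanov.BS r ℝ,
      ∀ᵐ t : ℝ, ∀ x₁ x₂ : X, ‖f t x₁ - f t x₂‖ ≤ L t * ‖x₁ - x₂‖) :
    ((∀ x : X, (fun t => f t x) ∈ Stepanov.Saa q Y) →
      Set.MapsTo (Stepanov.nemytskii f) (Stepanov.Saa p X) (Stepanov.Saa q Y) ∧
      Stepanov.StepanovContinuousOn p q (Stepanov.nemytskii f) (Stepanov.Saa p X)) ∧
    ((∀ x : X, (fun t => f t x) ∈ Stepanov.Sap q Y) →
      Set.MapsTo (Stepanov.nemytskii f) (Stepanov.Sap p X) (Stepanov.Sap q Y) ∧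
      Stepanov.StepanovContinuousOn p q (Stepanov.nemytskii f) (Stepanov.Sap p X)) := by
  obtain ⟨L, hL, hfL⟩ := hf
  have : ENNReal.HolderTriple r p q :=
    ⟨by rw [add_comm]; simpa only [one_div] using hpqr.symm⟩
  refine ⟨fun h => ⟨?_, Stepanov.stepanovContinuousOn_nemytskii hL hfL fun u hu => hu.1⟩,
    fun h => ⟨?_, Stepanov.stepanovContinuousOn_nemytskii hL hfL fun u hu => hu.1⟩⟩
  · rintro u ⟨hu, hua⟩
    choose hfx hfa using h
    have hN := Stepanov.MemLpLoc.nemytskii (q := q) hL.1 hfL hfx hu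
    exact ⟨hN, (Stepanov.isControlledBy_nemytskii hp hL hfL hfx hu
      (fun _ => hua.exists_finset_net) hN).isAlmostAutomorphic hua hfa⟩
  · rintro u ⟨hu, hua⟩
    choose hfx hfa using h
    have hN := Stepanov.MemLpLoc.nemytskii (q := q) hL.1 hfL hfx hu
    exact ⟨hN, (Stepanov.isControlledBy_nemytskii hp hL hfL hfx hu
      (fun _ => hua.exists_finset_net) hN).isAlmostPeriodic hua hfa⟩
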